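/- Let $S_n(1342)$ be the number of permutations $p$ of $\{1,\dots,n\}$ that avoid the pattern $1342$, i.e. for which there are no positions $i<j<k<l$ with $p(i)<p(l)<p(j)<p(k)$. For $n\ge 1$ let $$t_n = 3\cdot 2^{n-1}\cdot\frac{(2n)!}{(n+2)!\,n!}.$$ **Theorem.** 1. $\sqrt[n]{S_n(1342)}\to 8$ as $n\to\infty$. 2. $S_n(1342)<8^n$ for all $n\ge 1$. 3. $t_{n-1}\le S_n(1342)$ for all $n\ge 2$. 4. $t_n=\dfrac{(8n-4)\,t_{n-1}}{n+2}$ for all $n\ge 2$. 5. In particular, Stanley's conjecture that for every pattern $q$ of length $k$ the sequence $\sqrt[n]{S_n(q)}$ converges to $(k-1)^2$ (where $S_n(q)$ is the number of permutations of $\{1,\dots,n\}$ that avoid $q$) fails for $q=1342$: $\sqrt[n]{S_n(1342)}$ does not converge to $(4-1)^2=9$. -/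

import Mathlib

open Filter Topology
open scoped Nat

/-- The permutation `p` contains the pattern `q`: there are positions `f 0 < f 1 < ⋯` whose
entries `p (f 0), p (f 1), …` are in the same relative order as the entries of `q`. -/
def ContainsPattern {k n : ℕ} (q : Equiv.Perm (Fin k)) (p : Equiv.Perm (Fin n)) : Prop :=
  ∃ f : Fin k ↪o Fin n, ∀ a b : Fin k, q a < q b ↔ p (f a) < p (f b)

/-- The permutation `p` avoids the pattern `q`. -/
def AvoidsPattern {k n : ℕ} (q : Equiv.Perm (Fin k)) (p : Equiv.Perm (Fin n)) : Prop :=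
  ¬ ContainsPattern q p

/-- `S_n(q)`: the number of `n`-permutations that avoid the pattern `q`. -/
noncomputable def avoidCount {k : ℕ} (q : Equiv.Perm (Fin k)) (n : ℕ) : ℕ :=
  Nat.card {p : Equiv.Perm (Fin n) // AvoidsPattern q p}

/-- The pattern 1342; entries and positions are counted from `0`, so it is `0, 2, 3, 1`. -/
def pattern1342 : Equiv.Perm (Fin 4) where
  toFun := ![0, 2, 3, 1]
  invFun := ![0, 3, 1, 2]
  left_inv := by decide
  right_inv := by decide

/-- The numbers `t_n = 3 * 2 ^ (n - 1) * (2 n)! / ((n + 2)! n!)`, to be used for `n ≥ 1`. -/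
noncomputable def tutteNumber (n : ℕ) : ℝ :=
  3 * 2 ^ (n - 1) * ((2 * n)! : ℝ) / (((n + 2)! : ℝ) * (n ! : ℝ))

/-- Stanley's conjecture for one pattern `q` of length `k`: the `n`-th root of `S_n(q)` converges
to `(k - 1) ^ 2`. -/
def StanleyConjectureFor {k : ℕ} (q : Equiv.Perm (Fin k)) : Prop :=
  Tendsto (fun n : ℕ => (avoidCount q n : ℝ) ^ (1 / (n : ℝ))) atTop (𝓝 (((k : ℝ) - 1) ^ 2))

/-!
The 1342-avoiding permutations are counted exactly, by a functional equation for the series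
`A(x, u)` of nonempty 1342-avoiding words, where `x` marks the length and `u` the letters that exceed
the first one.

Let `p = L n R` avoid 1342, with `n` the largest letter. Two letters of `L` that are separated in
value by a letter of `R` occur in decreasing order. So, if `L` is nonempty, the letters of `L`
that no letter of `R` separates from the first one form a prefix whose values are an interval.
Contracting this prefix to a point factors `p` uniquely as a nonempty avoider `σ` inflating the
first letter of an indecomposable avoider (`exists_inflate`, `inflate_inj`). An indecomposable
avoider is determined by the word `T` that follows its first letter and by the gap `m` of values
into which that letter falls. If `T` starts with its largest letter, deletion of that letter
leaves an arbitrary nonempty avoider (`sum_Pr_head_max`); otherwise `T` is itself factored, and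
the possible gaps `m` are those that lie above some letter larger than the inflated prefix of `T`,
and below the largest letter (`mem_Pr_inflate`). With `Q` the series of these
indecomposable avoiders, in which `x` does not count the first letter, and `S = 1 + A(x, 1)`,
this says `A = x S + A Q` and `(u - 1) (Q - u A) = (S - 1) (Q - u Q(1))`,
and elimination of `Q` gives `u (1 - u) A ^ 2 - S (1 - u + u x) A + x S (S - u) = 0`
(`funEq_avSeries`).

This equation has only one solution divisible by `x` (`FunEq.unique`), and the solution is
explicit in terms of `w = √(1 - 8 x)` and a second square root (`exists_funEq`). It gives
`S = 32 x / (1 + 20 x - 8 x ^ 2 - (1 - 8 x) w)`. Hence `S = 1 / (1 - I)` with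
`I_n = 2 ^ (n - 3) (4 C_{n-1} - C_n)` for `n ≥ 2`, where `C_n` are the Catalan numbers; this is the Tutte number
`t_{n-1}` (`tutteNumber_eq_indec`). As `I` has nonnegative coefficients, `I_n ≤ S_n`. As
`∑ I_j / 8 ^ j` telescopes to at most `5 / 32`, the recursion `S_n = ∑ I_j S_{n-j}` gives `S_n < 8 ^ n` by
induction. The two bounds have the same exponential growth rate, which gives the limit `8`.
-/

namespace Avoid1342

/-! ### Words that avoid 1342 -/

/-- A word of natural numbers avoids 1342: it has no subsequence `a b c d` with
`a < d < b < c`. -/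
def Avoids (l : List ℕ) : Prop :=
  ∀ a b c d, [a, b, c, d].Sublist l → ¬ (a < d ∧ d < b ∧ b < c)

/-- The word `T` avoids 1342, and no subsequence `b c d` of `T` completes to the pattern when a new
first letter is put just below the value `m` (and above `m - 1`). -/
def Good (m : ℕ) (T : List ℕ) : Prop :=
  Avoids T ∧ ∀ b c d, [b, c, d].Sublist T → ¬ (m ≤ d ∧ d < b ∧ b < c)

/-- The shift of values that frees the interval `[m, m + s)`. -/
def openGap (m s x : ℕ) : ℕ := if x < m then x else x + s

theorem openGap_of_lt {m s x : ℕ} (h : x < m) : openGap m s x = x := if_pos h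

theorem openGap_of_le {m s x : ℕ} (h : m ≤ x) : openGap m s x = x + s := if_neg (not_lt.2 h)

theorem openGap_strictMono (m s : ℕ) : StrictMono (openGap m s) := by
  intro x y h
  unfold openGap
  split_ifs <;> omega

/-- The word obtained by putting a copy of the word `σ` in front of `T`, with its letters inserted
as an interval of values between `m - 1` and `m`. -/
def inflate (σ : List ℕ) (m : ℕ) (T : List ℕ) : List ℕ :=
  σ.map (· + m) ++ T.map (openGap m σ.length)

theorem Avoids.sublist {l l' : List ℕ} (h : Avoids l) (hl : l'.Sublist l) : Avoids l' :=
  fun a b c d hs => h a b c d (hs.trans hl)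

theorem avoids_map {f : ℕ → ℕ} (hf : StrictMono f) {l : List ℕ} :
    Avoids (l.map f) ↔ Avoids l := by
  constructor
  · intro h a b c d hs hlt
    refine h (f a) (f b) (f c) (f d) (by simpa using hs.map f) ?_
    simpa [hf.lt_iff_lt] using hlt
  · intro h a b c d hs hlt
    obtain ⟨l', hl', he⟩ := List.sublist_map_iff.1 hs
    obtain ⟨a', b', c', d', rfl⟩ : ∃ a' b' c' d', l' = [a', b', c', d'] := by
      have : l'.length = 4 := by simpa using (congrArg List.length he).symm
      match l', this with
      | [a', b', c', d'], _ => exact ⟨_, _, _, _, rfl⟩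
    simp only [List.map_cons, List.map_nil, List.cons.injEq, and_true] at he
    obtain ⟨rfl, rfl, rfl, rfl⟩ := he
    simp only [hf.lt_iff_lt] at hlt
    exact h _ _ _ _ hl' hlt

/-- If no letter of `T` lies strictly between two letters of `L`, then an occurrence of 1342 in
`L ++ T` lies in `L`, lies in `T`, or has exactly its first letter in `L`. -/
theorem avoids_append_iff {L T : List ℕ}
    (H : ∀ x ∈ T, ∀ y ∈ L, ∀ y' ∈ L, ¬ (y < x ∧ x < y')) :
    Avoids (L ++ T) ↔ Avoids L ∧ Avoids T ∧
      ∀ y ∈ L, ∀ b c d, [b, c, d].Sublist T → ¬ (y < d ∧ d < b ∧ b < c) := by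
  constructor
  · intro h
    refine ⟨h.sublist (List.sublist_append_left _ _), h.sublist (List.sublist_append_right _ _), ?_⟩
    intro y hy b c d hs
    exact h y b c d (List.Sublist.append (List.singleton_sublist.2 hy) hs)
  · rintro ⟨hL, hT, hLT⟩ a b c d hs hlt
    obtain ⟨l₁, l₂, he, h₁, h₂⟩ := List.sublist_append_iff.1 hs
    match l₁, he with
    | [], he => exact hT a b c d (by simpa [he] using h₂) hlt
    | [a'], he =>
      simp only [List.cons_append, List.nil_append, List.cons.injEq] at he
      obtain ⟨rfl, rfl⟩ := he
      exact hLT a (List.singleton_sublist.1 h₁) b c d h₂ hlt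
    | a' :: b' :: [], he =>
      simp only [List.cons_append, List.nil_append, List.cons.injEq] at he
      obtain ⟨rfl, rfl, rfl⟩ := he
      exact H d (h₂.subset (by simp)) a (h₁.subset (by simp)) b (h₁.subset (by simp))
        ⟨hlt.1, hlt.2.1⟩
    | a' :: b' :: c' :: [], he =>
      simp only [List.cons_append, List.nil_append, List.cons.injEq] at he
      obtain ⟨rfl, rfl, rfl, rfl⟩ := he
      exact H d (h₂.subset (by simp)) a (h₁.subset (by simp)) b (h₁.subset (by simp))
        ⟨hlt.1, hlt.2.1⟩
    | a' :: b' :: c' :: d' :: l', he =>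
      simp only [List.cons_append, List.cons.injEq] at he
      obtain ⟨rfl, rfl, rfl, rfl, he⟩ := he
      have : l' = [] := by
        have := congrArg List.length he
        simp at this
        exact List.eq_nil_of_length_eq_zero (by omega)
      subst this
      exact hL a b c d h₁ hlt

theorem std_iff {n : ℕ} {l : List ℕ} :
    l.Perm (List.range n) ↔ l.Nodup ∧ ∀ x, x ∈ l ↔ x < n := by
  constructor
  · intro h
    exact ⟨h.nodup_iff.2 List.nodup_range, fun x => by rw [h.mem_iff, List.mem_range]⟩
  · rintro ⟨h, hx⟩
    exact (List.perm_ext_iff_of_nodup h List.nodup_range).2 (by simpa using hx)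

theorem mem_openGap_bounds {m s t : ℕ} {x : ℕ} (hm : m ≤ t) :
    (∃ y < t, openGap m s y = x) ↔ (x < m ∨ (m + s ≤ x ∧ x < t + s)) := by
  constructor
  · rintro ⟨y, hy, rfl⟩
    unfold openGap
    split_ifs <;> omega
  · rintro (h | h)
    · exact ⟨x, by omega, openGap_of_lt h⟩
    · exact ⟨x - s, by omega, by rw [openGap_of_le (by omega)]; omega⟩

theorem inflate_std {σ T : List ℕ} {s t m : ℕ} (hσ : σ.Perm (List.range s))
    (hT : T.Perm (List.range t)) (hm : m ≤ t) : (inflate σ m T).Perm (List.range (s + t)) := by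
  have hs : σ.length = s := by simpa using hσ.length_eq
  rw [std_iff] at *
  have key : ∀ x, x ∈ T.map (openGap m s) ↔ (x < m ∨ (m + s ≤ x ∧ x < t + s)) := by
    intro x
    rw [← mem_openGap_bounds hm]
    simp [hT.2]
  have key2 : ∀ x, x ∈ σ.map (· + m) ↔ m ≤ x ∧ x < m + s := by
    intro x
    simp only [List.mem_map, hσ.2]
    exact ⟨by rintro ⟨y, hy, rfl⟩; omega, fun h => ⟨x - m, by omega, by omega⟩⟩
  unfold inflate
  rw [hs]
  refine ⟨List.Nodup.append (hσ.1.map (add_left_injective m))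
    (hT.1.map (openGap_strictMono m s).injective) ?_, ?_⟩
  · intro x h1 h2
    rw [key] at h2
    rw [key2] at h1
    omega
  · intro x
    rw [List.mem_append, key, key2]
    omega

theorem avoids_inflate_iff {σ T : List ℕ} {s m : ℕ} (hσ : σ.Perm (List.range s)) (hs : 1 ≤ s) :
    Avoids (inflate σ m T) ↔ Avoids σ ∧ Good m T := by
  have hl : σ.length = s := by simpa using hσ.length_eq
  have hmem := (std_iff.1 hσ).2
  have key2 : ∀ x, x ∈ σ.map (· + m) ↔ m ≤ x ∧ x < m + s := by
    intro x
    simp only [List.mem_map, hmem]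
    exact ⟨by rintro ⟨y, hy, rfl⟩; omega, fun h => ⟨x - m, by omega, by omega⟩⟩
  have hmono := openGap_strictMono m s
  unfold inflate Good
  rw [hl, avoids_append_iff, avoids_map (fun a b h => Nat.add_lt_add_right h m), avoids_map hmono]
  · refine and_congr_right fun _ => and_congr_right fun _ => ?_
    constructor
    · intro h b c d hs' hlt
      refine h m ((key2 m).2 (by omega)) (openGap m s b) (openGap m s c) (openGap m s d)
        (by simpa using hs'.map (openGap m s)) ⟨?_, hmono hlt.2.1, hmono hlt.2.2⟩
      rw [openGap_of_le hlt.1]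
      omega
    · intro h y hy b c d hs' hlt
      obtain ⟨l', hl', he⟩ := List.sublist_map_iff.1 hs'
      obtain ⟨b', c', d', rfl⟩ : ∃ b' c' d', l' = [b', c', d'] := by
        have : l'.length = 3 := by simpa using (congrArg List.length he).symm
        match l', this with
        | [b', c', d'], _ => exact ⟨_, _, _, rfl⟩
      simp only [List.map_cons, List.map_nil, List.cons.injEq, and_true] at he
      obtain ⟨rfl, rfl, rfl⟩ := he
      simp only [hmono.lt_iff_lt] at hlt
      refine h _ _ _ hl' ⟨?_, hlt.2⟩
      by_contra hd
      rw [openGap_of_lt (not_le.1 hd)] at hlt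
      have := (key2 y).1 hy
      omega
  · intro x hx y hy y' hy'
    rw [key2] at hy hy'
    obtain ⟨z, -, rfl⟩ := List.mem_map.1 hx
    unfold openGap
    split_ifs <;> omega

/-- A prefix `L` of a permutation whose values form an interval comes from `inflate`. -/
theorem exists_inflate_of_interval {L T : List ℕ} {n : ℕ} (hp : (L ++ T).Perm (List.range n))
    (hL : L ≠ []) (H : ∀ x ∈ T, ∀ y ∈ L, ∀ y' ∈ L, ¬ (y < x ∧ x < y')) :
    ∃ (σ : List ℕ) (m : ℕ) (T₀ : List ℕ), L = σ.map (· + m) ∧ T = T₀.map (openGap m σ.length) ∧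
      σ.Perm (List.range L.length) ∧ T₀.Perm (List.range T.length) ∧ m ≤ T.length := by
  have hn : L.length + T.length = n := by simpa using hp.length_eq
  obtain ⟨hnd, hmem⟩ := std_iff.1 hp
  have hndL := hnd.of_append_left
  have hndT := hnd.of_append_right
  have hdisj := List.disjoint_of_nodup_append hnd
  obtain ⟨m, hm, hmin⟩ := L.toFinset.exists_min_image id (by simpa using hL)
  obtain ⟨M, hM, hmax⟩ := L.toFinset.exists_max_image id (by simpa using hL)
  simp only [List.mem_toFinset, id] at hm hM hmin hmax
  have hLmem : ∀ x, x ∈ L ↔ m ≤ x ∧ x ≤ M := by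
    intro x
    refine ⟨fun h => ⟨hmin x h, hmax x h⟩, fun h => ?_⟩
    by_contra hx
    have h1 : x ∈ T := by
      have := (hmem M).1 (List.mem_append_left _ hM)
      have := (hmem x).2 (by omega)
      simpa [hx] using this
    have : x ≠ m := fun h => hx (h ▸ hm)
    have : x ≠ M := fun h => hx (h ▸ hM)
    exact H x h1 m hm M hM (by omega)
  have hmM : m ≤ M := hmin M hM
  -- As `L` holds all letters between its minimum and its maximum, its length gives the interval.
  have hlen : L.length = M + 1 - m := by
    have : L.Perm (List.range' m (M + 1 - m)) := by
      rw [List.perm_ext_iff_of_nodup hndL List.nodup_range']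
      intro x
      rw [hLmem, List.mem_range'_1]
      omega
    simpa using this.length_eq
  set s := L.length with hs
  have hMn : M < n := (hmem M).1 (List.mem_append_left _ hM)
  have hTmem : ∀ x, x ∈ T ↔ x < m ∨ (m + s ≤ x ∧ x < n) := by
    intro x
    have h1 := hmem x
    rw [List.mem_append, hLmem] at h1
    have h2 : x ∈ L → x ∉ T := fun a b => hdisj a b
    rw [hLmem] at h2
    by_cases h : x ∈ T
    · simp only [h, or_true, true_iff] at h1 ⊢
      have := mt h2 (not_not.2 h)
      omega
    · simp only [h, or_false, false_iff] at h1 ⊢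
      omega
  have hσ : (L.map (· - m)).map (· + m) = L := by
    rw [List.map_map]
    conv_rhs => rw [← List.map_id L]
    refine List.map_congr_left fun x hx => ?_
    have := (hLmem x).1 hx
    simp only [Function.comp_apply, id]
    omega
  have hT₀ : (T.map (fun x => if x < m then x else x - s)).map (openGap m s) = T := by
    rw [List.map_map]
    conv_rhs => rw [← List.map_id T]
    refine List.map_congr_left fun x hx => ?_
    have := (hTmem x).1 hx
    simp only [Function.comp_apply, id, openGap]
    split_ifs <;> omega
  refine ⟨L.map (· - m), m, T.map (fun x => if x < m then x else x - s), hσ.symm,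
    by rw [List.length_map]; exact hT₀.symm, ?_, ?_, by omega⟩
  · rw [std_iff]
    constructor
    · rw [← hσ] at hndL
      exact hndL.of_map _
    · intro x
      rw [List.mem_map]
      refine ⟨?_, fun h => ⟨x + m, (hLmem _).2 (by omega), by omega⟩⟩
      rintro ⟨y, hy, rfl⟩
      have := (hLmem y).1 hy
      omega
  · rw [std_iff]
    constructor
    · rw [← hT₀] at hndT
      exact hndT.of_map _
    · intro x
      rw [List.mem_map]
      constructor
      · rintro ⟨y, hy, rfl⟩
        have := (hTmem y).1 hy
        split_ifs <;> omega
      · intro h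
        by_cases hx : x < m
        · exact ⟨x, (hTmem _).2 (by omega), by simp [hx]⟩
        · refine ⟨x + s, (hTmem _).2 (by omega), ?_⟩
          rw [if_neg (by omega)]
          omega

end Avoid1342

namespace Avoid1342

/-! ### Splitting a word at its largest letter -/

/-- `T`, a permutation of `0, …, t - 1`, is `L ++ (t - 1) :: R`, and every letter of `L` is
separated from the gap below `m` by a letter of `R`. This is the condition on `T` that makes the
factorization `p = inflate σ m T` unique: `σ` is then the longest prefix of `p` that precedes the
largest letter and whose letters are not separated by letters that follow the largest one. -/
def Prim (m t : ℕ) (T : List ℕ) : Prop :=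
  ∃ L R, T = L ++ (t - 1) :: R ∧ ∀ z ∈ L, ∃ r ∈ R, z < r ∧ r < m

open Classical in
/-- The words on the letters `0, …, n - 1`, each used once, that avoid 1342. -/
noncomputable def Av (n : ℕ) : Finset (List ℕ) :=
  {l ∈ (List.range n).permutations.toFinset | Avoids l}

theorem mem_Av {n : ℕ} {l : List ℕ} : l ∈ Av n ↔ l.Perm (List.range n) ∧ Avoids l := by
  classical
  simp [Av]

open Classical in
/-- The pairs `(m, T)` where `T` is a permutation of `0, …, t - 1` and `m < t` is a gap of values
such that putting a new first letter into that gap gives a 1342-avoiding word that is indecomposable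
with respect to `inflate`. -/
noncomputable def Pr (t : ℕ) : Finset (ℕ × List ℕ) :=
  {q ∈ Finset.range t ×ˢ (List.range t).permutations.toFinset | Good q.1 q.2 ∧ Prim q.1 t q.2}

theorem mem_Pr {t m : ℕ} {T : List ℕ} :
    (m, T) ∈ Pr t ↔ m < t ∧ T.Perm (List.range t) ∧ Good m T ∧ Prim m t T := by
  classical
  simp [Pr, and_assoc]

theorem length_of_perm_range {n : ℕ} {l : List ℕ} (h : l.Perm (List.range n)) : l.length = n := by
  simpa using h.length_eq

theorem mem_map_add_iff {σ : List ℕ} {s m x : ℕ} (hσ : σ.Perm (List.range s)) :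
    x ∈ σ.map (· + m) ↔ m ≤ x ∧ x < m + s := by
  simp only [List.mem_map, (std_iff.1 hσ).2]
  exact ⟨by rintro ⟨y, hy, rfl⟩; omega, fun h => ⟨x - m, by omega, by omega⟩⟩

theorem split_unique {n : ℕ} {L R L' R' : List ℕ} (hp : (L ++ (n - 1) :: R).Perm (List.range n))
    (he : L ++ (n - 1) :: R = L' ++ (n - 1) :: R') : L = L' ∧ R = R' := by
  have hnd := (std_iff.1 hp).1
  have hnd' := he ▸ hnd
  have h1 : n - 1 ∉ L := fun h => List.disjoint_of_nodup_append hnd h (by simp)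
  have h2 : n - 1 ∉ L' := fun h => List.disjoint_of_nodup_append hnd' h (by simp)
  rw [List.append_eq_append_iff] at he
  rcases he with ⟨a, ha, hb⟩ | ⟨a, ha, hb⟩
  · cases a with
    | nil => simp_all
    | cons x a =>
      simp only [List.cons_append, List.cons.injEq] at hb
      exact absurd (by rw [ha, hb.1]; simp) h2
  · cases a with
    | nil => simp_all
    | cons x a =>
      simp only [List.cons_append, List.cons.injEq] at hb
      exact absurd (by rw [ha, hb.1]; simp) h1

theorem openGap_max {m s t : ℕ} (hm : m < t) : openGap m s (t - 1) = s + t - 1 := by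
  rw [openGap_of_le (by omega)]
  omega

/-- In a 1342-avoiding word, two letters before the largest one that are separated by a letter
after the largest one occur in decreasing order. -/
theorem pairwise_of_avoids {n : ℕ} {L R : List ℕ} (hp : (L ++ (n - 1) :: R).Perm (List.range n))
    (ha : Avoids (L ++ (n - 1) :: R)) :
    L.Pairwise fun y z => ∀ r ∈ R, ¬ (y < r ∧ r < z) := by
  obtain ⟨hnd, hmem⟩ := std_iff.1 hp
  rw [List.pairwise_iff_forall_sublist]
  intro y z hs r hr hlt
  refine ha y z (n - 1) r (List.Sublist.append hs
    (List.Sublist.cons_cons _ (List.singleton_sublist.2 hr))) ⟨hlt.1, hlt.2, ?_⟩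
  have hz : z ∈ L := hs.subset (by simp)
  have h1 := (hmem z).1 (List.mem_append_left _ hz)
  have h2 : z ≠ n - 1 := fun h => List.disjoint_of_nodup_append hnd hz (by simp [h])
  omega

theorem exists_inflate {n : ℕ} {L R : List ℕ} (hp : (L ++ (n - 1) :: R).Perm (List.range n))
    (ha : Avoids (L ++ (n - 1) :: R)) (hL : L ≠ []) :
    ∃ s t σ m T, s + t = n ∧ 1 ≤ s ∧ σ ∈ Av s ∧ (m, T) ∈ Pr t ∧
      L ++ (n - 1) :: R = inflate σ m T := by
  classical
  obtain ⟨hnd, hmem⟩ := std_iff.1 hp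
  have hpw := pairwise_of_avoids hp ha
  obtain ⟨h, L', rfl⟩ := List.exists_cons_of_ne_nil hL
  -- `q x` says that no letter of `R` separates `x` from the first letter `h`. The letters with this
  -- property form a prefix of `h :: L'`, as separated letters occur in decreasing order.
  set q : ℕ → Bool := fun x => decide (∀ r ∈ R, h < r ↔ x < r) with hq
  have hqh : q h = true := by simp [hq]
  set L₁ := (h :: L').takeWhile q with hL₁
  set L₂ := (h :: L').dropWhile q with hL₂
  have hsplit : L₁ ++ L₂ = h :: L' := List.takeWhile_append_dropWhile
  have hh : h ∈ L₁ := by rw [hL₁, List.takeWhile_cons_of_pos hqh]; simp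
  have h1 : ∀ y ∈ L₁, ∀ r ∈ R, h < r ↔ y < r := by
    intro y hy
    simpa [hq] using List.mem_takeWhile_imp hy
  have hne : ∀ y ∈ h :: L', ∀ r ∈ R, y ≠ r := fun y hy r hr e =>
    List.disjoint_of_nodup_append hnd hy (by simp [e, hr])
  have hlast : ∀ y ∈ h :: L', y < n - 1 := by
    intro y hy
    have h1 := (hmem y).1 (List.mem_append_left _ hy)
    have h2 : y ≠ n - 1 := fun h => List.disjoint_of_nodup_append hnd hy (by simp [h])
    omega
  have hsub₁ : ∀ y ∈ L₁, y ∈ h :: L' := fun y hy => hsplit ▸ List.mem_append_left _ hy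
  have hsub₂ : ∀ y ∈ L₂, y ∈ h :: L' := fun y hy => hsplit ▸ List.mem_append_right _ hy
  have hsep : ∀ z ∈ L₂, ∃ r ∈ R, z < r ∧ r < h := by
    rcases hL₂e : L₂ with _ | ⟨z₀, Z⟩
    · simp
    · have hz₀ : q z₀ ≠ true := by
        have hlen : 0 < L₂.length := by rw [hL₂e]; simp
        have := List.dropWhile_get_zero_not q (h :: L') hlen
        simpa [← hL₂, hL₂e] using this
      have hz₀L : z₀ ∈ h :: L' := hsub₂ z₀ (by rw [hL₂e]; simp)
      have hz₀h : z₀ ∈ L' := by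
        rcases List.mem_cons.1 hz₀L with e | e
        · exact absurd (e ▸ hqh) hz₀
        · exact e
      obtain ⟨r, hr, hrz⟩ : ∃ r ∈ R, ¬ (h < r ↔ z₀ < r) := by
        simpa [hq] using hz₀
      have a1 := (List.pairwise_cons.1 hpw).1 z₀ hz₀h r hr
      have a2 := hne z₀ hz₀L r hr
      have a3 := hne h (by simp) r hr
      have hzr : z₀ < r ∧ r < h := by omega
      intro z hz
      refine ⟨r, hr, ?_, hzr.2⟩
      rcases List.mem_cons.1 hz with rfl | hz'
      · exact hzr.1
      · have hpw₂ : L₂.Pairwise fun y z => ∀ r ∈ R, ¬ (y < r ∧ r < z) :=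
          (List.pairwise_append.1 (hsplit.symm ▸ hpw)).2.1
        rw [hL₂e] at hpw₂
        have b1 := (List.pairwise_cons.1 hpw₂).1 z hz' r hr
        have b2 := hne z (hsub₂ z (by rw [hL₂e]; simp [hz'])) r hr
        omega
  have hpe : h :: L' ++ (n - 1) :: R = L₁ ++ (L₂ ++ (n - 1) :: R) := by
    rw [← List.append_assoc, hsplit]
  have hp' := hpe ▸ hp
  obtain ⟨σ, m, T, hσ, hT, hσp, hTp, hm⟩ := exists_inflate_of_interval hp'
    (List.ne_nil_of_mem hh) (by
      intro x hx y hy y' hy' hlt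
      rcases List.mem_append.1 hx with hx | hx
      · obtain ⟨r, hr, hr'⟩ := hsep x hx
        have := h1 y hy r hr
        omega
      · rcases List.mem_cons.1 hx with rfl | hx
        · have := hlast y' (hsub₁ y' hy')
          omega
        · have b1 := h1 y hy x hx
          have b2 := h1 y' hy' x hx
          omega)
  set s := L₁.length with hs
  set t := (L₂ ++ (n - 1) :: R).length with ht
  have hσl : σ.length = s := length_of_perm_range hσp
  rw [hσl] at hT
  have hst : s + t = n := by
    have := length_of_perm_range hp'
    rwa [List.length_append] at this
  have hs1 : 1 ≤ s := List.length_pos_of_mem hh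
  have hpi : h :: L' ++ (n - 1) :: R = inflate σ m T := by
    rw [hpe]
    unfold inflate
    rw [hσl, ← hT, ← hσ]
  have hav := (avoids_inflate_iff (m := m) (T := T) hσp hs1).1 (hpi ▸ ha)
  have hmemL : ∀ x, x ∈ L₁ ↔ m ≤ x ∧ x < m + s := fun x => by
    rw [hσ]
    exact mem_map_add_iff hσp
  have hmt : m < t := by
    have := hlast _ (hsub₁ (m + s - 1) ((hmemL _).2 (by omega)))
    omega
  refine ⟨s, t, σ, m, T, hst, hs1, mem_Av.2 ⟨hσp, hav.1⟩,
    mem_Pr.2 ⟨hmt, hTp, hav.2, ?_⟩, hpi⟩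
  obtain ⟨A, B, rfl, hA, hB⟩ := List.map_eq_append_iff.1 hT.symm
  obtain ⟨M, R₀, rfl, hM, hR⟩ := List.map_eq_cons_iff.1 hB
  have hmono := openGap_strictMono m s
  have hMt : M = t - 1 := hmono.injective (by rw [hM, openGap_max hmt, hst])
  refine ⟨A, R₀, by rw [hMt], ?_⟩
  intro z hz
  obtain ⟨r, hr, hzr, hrh⟩ := hsep (openGap m s z) (hA ▸ List.mem_map_of_mem hz)
  rw [← hR] at hr
  obtain ⟨r₀, hr₀, rfl⟩ := List.mem_map.1 hr
  refine ⟨r₀, hr₀, hmono.lt_iff_lt.1 hzr, ?_⟩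
  by_contra hcon
  rw [openGap_of_le (not_lt.1 hcon)] at hrh
  have := (hmemL h).1 hh
  omega

/-- A primitive factorization displayed as a splitting of the word at its largest letter. -/
theorem inflate_split {s t m : ℕ} {σ T : List ℕ} (hσ : σ.Perm (List.range s))
    (hm : m < t) (hP : Prim m t T) :
    ∃ L₂ R, inflate σ m T = (σ.map (· + m) ++ L₂) ++ (s + t - 1) :: R ∧
      T.map (openGap m s) = L₂ ++ (s + t - 1) :: R ∧
      ∀ z ∈ L₂, ∃ r ∈ R, z < r ∧ r < m := by
  obtain ⟨A, B, rfl, hAB⟩ := hP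
  have hl := length_of_perm_range hσ
  refine ⟨A.map (openGap m s), B.map (openGap m s), ?_, ?_, ?_⟩
  · unfold inflate
    simp [hl, openGap_max hm]
  · simp [openGap_max hm]
  · intro z hz
    obtain ⟨z₀, hz₀, rfl⟩ := List.mem_map.1 hz
    obtain ⟨r, hr, h1, h2⟩ := hAB z₀ hz₀
    refine ⟨openGap m s r, List.mem_map_of_mem hr, openGap_strictMono m s h1, ?_⟩
    rwa [openGap_of_lt h2]

theorem inflate_mem_Av {s t m : ℕ} {σ T : List ℕ} (hσ : σ ∈ Av s) (hs : 1 ≤ s)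
    (hT : (m, T) ∈ Pr t) : inflate σ m T ∈ Av (s + t) := by
  rw [mem_Av] at hσ ⊢
  rw [mem_Pr] at hT
  exact ⟨inflate_std hσ.1 hT.2.1 hT.1.le, (avoids_inflate_iff hσ.1 hs).2 ⟨hσ.2, hT.2.2.1⟩⟩

theorem headD_inflate {s m : ℕ} {σ T : List ℕ} (hσ : σ.Perm (List.range s)) (hs : 1 ≤ s) :
    (inflate σ m T).headD 0 = σ.headD 0 + m := by
  have hl := length_of_perm_range hσ
  cases σ with
  | nil => simp at hl; omega
  | cons a σ => simp [inflate]

theorem inflate_inj {s t s' t' m m' : ℕ} {σ T σ' T' : List ℕ} (hσ : σ ∈ Av s) (hs : 1 ≤ s)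
    (hT : (m, T) ∈ Pr t) (hσ' : σ' ∈ Av s') (hs' : 1 ≤ s') (hT' : (m', T') ∈ Pr t')
    (hst : s + t = s' + t') (he : inflate σ m T = inflate σ' m' T') :
    s = s' ∧ t = t' ∧ σ = σ' ∧ m = m' ∧ T = T' := by
  have hp := (mem_Av.1 (inflate_mem_Av hσ hs hT)).1
  rw [mem_Av] at hσ hσ'
  rw [mem_Pr] at hT hT'
  obtain ⟨L₂, R, e1, e2, e3⟩ := inflate_split hσ.1 hT.1 hT.2.2.2
  obtain ⟨L₂', R', e1', e2', e3'⟩ := inflate_split hσ'.1 hT'.1 hT'.2.2.2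
  have hm1 : ∀ x, x ∈ σ.map (· + m) ↔ m ≤ x ∧ x < m + s := fun x => mem_map_add_iff hσ.1
  have hm2 : ∀ x, x ∈ σ'.map (· + m') ↔ m' ≤ x ∧ x < m' + s' := fun x => mem_map_add_iff hσ'.1
  have hx : (σ.map (· + m) ++ L₂) ++ (s + t - 1) :: R
      = (σ'.map (· + m') ++ L₂') ++ (s + t - 1) :: R' := by
    rw [← e1, he, e1', hst]
  obtain ⟨f1, rfl⟩ := split_unique (e1 ▸ hp) hx
  have hdisj : ∀ r ∈ R, r ∉ σ.map (· + m) ∧ r ∉ σ'.map (· + m') := by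
    intro r hr
    have hnd := (std_iff.1 (e1 ▸ hp)).1
    have hnd' := hx ▸ hnd
    exact ⟨fun h => List.disjoint_of_nodup_append hnd (List.mem_append_left _ h) (by simp [hr]),
      fun h => List.disjoint_of_nodup_append hnd' (List.mem_append_left _ h) (by simp [hr])⟩
  have key : σ.map (· + m) = σ'.map (· + m') := by
    rw [List.append_eq_append_iff] at f1
    -- If one prefix were longer, its last letters would be separated from its first ones by a
    -- letter of `R`, although its values form an interval.
    rcases f1 with ⟨a, ha, hb⟩ | ⟨a, ha, hb⟩
    · cases a with
      | nil => simpa using ha.symm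
      | cons z a =>
        exfalso
        obtain ⟨r, hr, h1, h2⟩ := e3 z (by rw [hb]; simp)
        have h3 := (hdisj r hr).2
        have h4 := (hm2 z).1 (by rw [ha]; simp)
        have h5 := (hm2 m).1 (by rw [ha]; exact List.mem_append_left _ ((hm1 m).2 (by omega)))
        rw [hm2] at h3
        omega
    · cases a with
      | nil => simpa using ha
      | cons z a =>
        exfalso
        obtain ⟨r, hr, h1, h2⟩ := e3' z (by rw [hb]; simp)
        have h3 := (hdisj r hr).1
        have h4 := (hm1 z).1 (by rw [ha]; simp)
        have h5 := (hm1 m').1 (by rw [ha]; exact List.mem_append_left _ ((hm2 m').2 (by omega)))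
        rw [hm1] at h3
        omega
  have hss : s = s' := by
    have := congrArg List.length key
    rw [List.length_map, List.length_map, length_of_perm_range hσ.1,
      length_of_perm_range hσ'.1] at this
    exact this
  have hmm : m = m' := by
    have h1 := (hm2 m).1 (key ▸ (hm1 m).2 (by omega))
    have h2 := (hm1 m').1 (key ▸ (hm2 m').2 (by omega))
    omega
  subst hss hmm
  refine ⟨rfl, by omega, List.map_injective_iff.2 (add_left_injective m) key, rfl, ?_⟩
  refine List.map_injective_iff.2 (openGap_strictMono m s).injective ?_
  rw [key] at f1
  rw [e2, e2', List.append_cancel_left f1, hst]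

end Avoid1342

namespace Avoid1342

/-! ### The recursions for the enumerating polynomials -/

open Finset.HasAntidiagonal (antidiagonal mem_antidiagonal)

/-- The nonempty words of `Av n`. -/
noncomputable def AvPos (n : ℕ) : Finset (List ℕ) := if n = 0 then ∅ else Av n

theorem mem_AvPos {n : ℕ} {l : List ℕ} : l ∈ AvPos n ↔ 1 ≤ n ∧ l ∈ Av n := by
  unfold AvPos
  split_ifs with h
  · simp [h]
  · simp [h, Nat.one_le_iff_ne_zero]

/-- The words of `Av n` that do not start with their largest letter. -/
noncomputable def AvSmall (n : ℕ) : Finset (List ℕ) := {l ∈ Av n | l.headD 0 + 1 < n}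

theorem headD_lt {n : ℕ} {l : List ℕ} (hl : l.Perm (List.range n)) (hn : 1 ≤ n) :
    l.headD 0 < n := by
  cases l with
  | nil => exact hn
  | cons a l => exact ((std_iff.1 hl).2 a).1 (by simp)

theorem ne_nil_of_perm_range {n : ℕ} {l : List ℕ} (hl : l.Perm (List.range n)) (hn : 1 ≤ n) :
    l ≠ [] := by
  rintro rfl
  have := length_of_perm_range hl
  simp at this
  omega

theorem sum_AvSmall {M : Type*} [AddCommMonoid M] (n : ℕ) (f : List ℕ → M) :
    ∑ l ∈ AvSmall n, f l = ∑ st ∈ antidiagonal n, ∑ σ ∈ AvPos st.1, ∑ q ∈ Pr st.2,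
      f (inflate σ q.1 q.2) := by
  simp_rw [← Finset.sum_product' (AvPos _) (Pr _) fun σ q => f (inflate σ q.1 q.2)]
  rw [Finset.sum_sigma']
  symm
  refine Finset.sum_bij (fun x _ => inflate x.2.1 x.2.2.1 x.2.2.2) ?_ ?_ ?_ fun _ _ => rfl
  · rintro ⟨⟨s, t⟩, σ, m, T⟩ hx
    simp only [Finset.mem_sigma, mem_antidiagonal, Finset.mem_product, mem_AvPos] at hx
    obtain ⟨rfl, ⟨hs, hσ⟩, hT⟩ := hx
    have h1 := headD_lt (mem_Av.1 hσ).1 hs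
    have h2 := (mem_Pr.1 hT).1
    simp only [AvSmall, Finset.mem_filter]
    refine ⟨inflate_mem_Av hσ hs hT, ?_⟩
    rw [headD_inflate (mem_Av.1 hσ).1 hs]
    omega
  · rintro ⟨⟨s, t⟩, σ, m, T⟩ hx ⟨⟨s', t'⟩, σ', m', T'⟩ hx' he
    simp only [Finset.mem_sigma, mem_antidiagonal, Finset.mem_product, mem_AvPos] at hx hx'
    obtain ⟨h1, ⟨hs, hσ⟩, hT⟩ := hx
    obtain ⟨h1', ⟨hs', hσ'⟩, hT'⟩ := hx'
    obtain ⟨rfl, rfl, rfl, rfl, rfl⟩ := inflate_inj hσ hs hT hσ' hs' hT' (by omega) he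
    rfl
  · intro l hl
    simp only [AvSmall, Finset.mem_filter] at hl
    obtain ⟨hl, hh⟩ := hl
    rw [mem_Av] at hl
    obtain ⟨L, R, rfl⟩ := List.mem_iff_append.1 (((std_iff.1 hl.1).2 (n - 1)).2 (by omega))
    have hL : L ≠ [] := by
      rintro rfl
      simp at hh
      omega
    obtain ⟨s, t, σ, m, T, hst, hs, hσ, hT, he⟩ := exists_inflate hl.1 hl.2 hL
    refine ⟨⟨(s, t), σ, m, T⟩, ?_, he.symm⟩
    simp only [Finset.mem_sigma, mem_antidiagonal, Finset.mem_product, mem_AvPos]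
    exact ⟨hst, ⟨hs, hσ⟩, hT⟩

theorem avoids_max_cons {n : ℕ} {R : List ℕ} (hR : R.Perm (List.range n)) :
    Avoids (n :: R) ↔ Avoids R := by
  refine ⟨fun h => h.sublist (List.sublist_cons_self _ _), fun h => ?_⟩
  intro a b c d hs hlt
  rcases List.sublist_cons_iff.1 hs with hs | ⟨r, hr, hs⟩
  · exact h a b c d hs hlt
  · simp only [List.cons.injEq] at hr
    obtain ⟨rfl, rfl⟩ := hr
    have := ((std_iff.1 hR).2 d).1 (hs.subset (by simp))
    omega

theorem good_max_cons {m n : ℕ} {R : List ℕ} (hR : R.Perm (List.range n)) :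
    Good m (n :: R) ↔ Good m R := by
  unfold Good
  rw [avoids_max_cons hR]
  refine and_congr_right fun _ => ⟨
    fun h b c d hs => h b c d (hs.trans (List.sublist_cons_self _ _)),
    fun h b c d hs hlt => ?_⟩
  rcases List.sublist_cons_iff.1 hs with hs | ⟨r, hr, hs⟩
  · exact h b c d hs hlt
  · simp only [List.cons.injEq] at hr
    obtain ⟨rfl, rfl⟩ := hr
    have := ((std_iff.1 hR).2 c).1 (hs.subset (by simp))
    omega

theorem max_cons_perm_iff {n : ℕ} {R : List ℕ} :
    (n :: R).Perm (List.range (n + 1)) ↔ R.Perm (List.range n) := by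
  rw [List.range_succ]
  refine (List.Perm.congr_right (List.perm_append_singleton n (List.range n)) _).trans ?_
  exact List.perm_cons n

theorem eq_max_cons {n : ℕ} {l : List ℕ} (hl : l.Perm (List.range (n + 1)))
    (hh : l.headD 0 = n) : ∃ R, l = n :: R ∧ R.Perm (List.range n) := by
  cases l with
  | nil => exact absurd rfl (ne_nil_of_perm_range hl (by omega))
  | cons a R =>
    simp only [List.headD_cons] at hh
    subst hh
    exact ⟨R, rfl, max_cons_perm_iff.1 hl⟩

open Classical in
theorem card_head_max (n : ℕ) :
    (((Av (n + 1)).filter fun l => ¬ (l.headD 0 + 1 < n + 1)).card) = (Av n).card := by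
  symm
  refine Finset.card_bij (fun R _ => n :: R) ?_ (fun _ _ _ _ h => (List.cons.inj h).2) ?_
  · intro R hR
    rw [mem_Av] at hR
    simp [mem_Av, max_cons_perm_iff, avoids_max_cons hR.1, hR]
  · intro l hl
    simp only [Finset.mem_filter, mem_Av] at hl
    have := headD_lt hl.1.1 (by omega)
    obtain ⟨R, rfl, hR⟩ := eq_max_cons hl.1.1 (by omega)
    exact ⟨R, mem_Av.2 ⟨hR, (avoids_max_cons hR).1 hl.1.2⟩, rfl⟩

open Polynomial

/-- The nonempty 1342-avoiding words of length `n`, each weighted by `u ^ j`, where `j` is the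
number of letters that exceed the first letter. -/
noncomputable def avPoly (n : ℕ) : ℚ[X] := ∑ l ∈ AvPos n, X ^ (n - 1 - l.headD 0)

/-- The pairs of `Pr t`, each weighted by `u ^ j`, where `j` is the number of letters that exceed
the new first letter. -/
noncomputable def prPoly (t : ℕ) : ℚ[X] := ∑ q ∈ Pr t, X ^ (t - q.1)

theorem avPoly_succ (n : ℕ) :
    avPoly (n + 1) = ((Av n).card : ℚ[X]) +
      ∑ st ∈ antidiagonal (n + 1), avPoly st.1 * prPoly st.2 := by
  classical
  have h0 : avPoly (n + 1) = ∑ l ∈ Av (n + 1), X ^ (n - l.headD 0) := by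
    simp [avPoly, AvPos]
  rw [h0, ← Finset.sum_filter_not_add_sum_filter _ fun l : List ℕ => l.headD 0 + 1 < n + 1]
  congr 1
  · rw [← card_head_max, Finset.card_eq_sum_ones, Nat.cast_sum]
    refine Finset.sum_congr rfl fun l hl => ?_
    simp only [Finset.mem_filter] at hl
    rw [show n - l.headD 0 = 0 by omega]
    simp
  · refine (sum_AvSmall (n + 1) fun l => (X : ℚ[X]) ^ (n - l.headD 0)).trans ?_
    refine Finset.sum_congr rfl ?_
    rintro ⟨s, t⟩ hst
    rw [mem_antidiagonal] at hst
    rw [avPoly, prPoly, Finset.sum_mul_sum]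
    refine Finset.sum_congr rfl fun σ hσ => Finset.sum_congr rfl ?_
    rintro ⟨m, T⟩ hq
    rw [mem_AvPos] at hσ
    have h1 := headD_lt (mem_Av.1 hσ.2).1 hσ.1
    have h2 := (mem_Pr.1 hq).1
    dsimp only at *
    rw [headD_inflate (mem_Av.1 hσ.2).1 hσ.1, ← pow_add]
    congr 1
    omega

theorem inflate_singleton (m : ℕ) (R : List ℕ) :
    inflate [0] m R = m :: R.map (openGap m 1) := by
  simp [inflate]

theorem singleton_mem_Av : [0] ∈ Av 1 := by
  refine mem_Av.2 ⟨by simp [List.range_succ], ?_⟩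
  intro a b c d hs
  have := hs.length_le
  simp at this

open Classical in
/-- Pairs `(m, (t - 1) :: R)` correspond to the nonempty 1342-avoiding words, by deletion of the
largest letter. -/
theorem sum_Pr_head_max (t : ℕ) :
    ∑ q ∈ (Pr (t + 1)).filter (fun q => ¬ (q.2.headD 0 + 1 < t + 1)), (X : ℚ[X]) ^ (t + 1 - q.1)
      = X * avPoly (t + 1) := by
  rw [avPoly, Finset.mul_sum]
  refine Finset.sum_bij (fun q _ => inflate [0] q.1 q.2.tail) ?_ ?_ ?_ ?_
  · rintro ⟨m, T⟩ hq
    simp only [Finset.mem_filter, mem_Pr] at hq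
    obtain ⟨⟨hm, hT, hG, -⟩, hh⟩ := hq
    have := headD_lt hT (by omega)
    obtain ⟨R, rfl, hR⟩ := eq_max_cons hT (by omega)
    rw [mem_AvPos, mem_Av]
    have h1 : [0].Perm (List.range 1) := (mem_Av.1 singleton_mem_Av).1
    refine ⟨by omega, by rw [Nat.add_comm]; exact inflate_std h1 hR (by omega),
      (avoids_inflate_iff h1 le_rfl).2
      ⟨(mem_Av.1 singleton_mem_Av).2, (good_max_cons hR).1 hG⟩⟩
  · rintro ⟨m, T⟩ hq ⟨m', T'⟩ hq' he
    simp only [Finset.mem_filter, mem_Pr] at hq hq'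
    obtain ⟨⟨hm, hT, hG, -⟩, hh⟩ := hq
    obtain ⟨⟨hm', hT', hG', -⟩, hh'⟩ := hq'
    have := headD_lt hT (by omega)
    have := headD_lt hT' (by omega)
    obtain ⟨R, rfl, hR⟩ := eq_max_cons hT (by omega)
    obtain ⟨R', rfl, hR'⟩ := eq_max_cons hT' (by omega)
    simp only [inflate_singleton, List.tail_cons, List.cons.injEq] at he
    obtain ⟨rfl, he⟩ := he
    rw [List.map_injective_iff.2 (openGap_strictMono m 1).injective he]
  · intro l hl
    rw [mem_AvPos, mem_Av] at hl
    obtain ⟨-, hl, ha⟩ := hl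
    obtain ⟨h, l', rfl⟩ := List.exists_cons_of_ne_nil (ne_nil_of_perm_range hl (by omega))
    obtain ⟨σ, m, R, e1, e2, hσ, hR, hm⟩ := exists_inflate_of_interval (L := [h]) (T := l')
      (by simpa using hl) (by simp) (by simp; omega)
    have hl' : l'.length = t := by simpa using length_of_perm_range hl
    rw [hl'] at hR hm
    have hσ0 : σ = [0] := by simpa [List.range_succ] using hσ
    subst hσ0
    have hm' : m = h := by simpa using e1.symm
    subst hm'
    have he : m :: l' = inflate [0] m R := by rw [inflate_singleton, e2]; simp
    rw [he, avoids_inflate_iff hσ le_rfl] at ha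
    refine ⟨(m, t :: R), ?_, he.symm⟩
    simp only [Finset.mem_filter, mem_Pr]
    exact ⟨⟨by omega, max_cons_perm_iff.2 hR, (good_max_cons hR).2 ha.2, [], R, by simp, by simp⟩,
      by simp⟩
  · rintro ⟨m, T⟩ hq
    simp only [Finset.mem_filter, mem_Pr] at hq
    rw [inflate_singleton, List.headD_cons, ← pow_succ']
    congr 1
    omega

/-- A new first letter below the gap `m` may be put in front of `inflate σ m' T'` with an
indecomposable 1342-avoiding result exactly if some letter lies between the copy of `σ` and that
gap: the letters above the copy of `σ` are the largest letter and letters to its right. -/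
theorem mem_Pr_inflate {s t m m' : ℕ} {σ T : List ℕ} (hσ : σ ∈ Av s) (hs : 1 ≤ s)
    (hT : (m', T) ∈ Pr t) :
    (m, inflate σ m' T) ∈ Pr (s + t) ↔ m' + s < m ∧ m < s + t := by
  have hmem := inflate_mem_Av hσ hs hT
  rw [mem_Av] at hσ hmem
  rw [mem_Pr] at hT
  obtain ⟨L₂, R, e1, e2, e3⟩ := inflate_split hσ.1 hT.1 hT.2.2.2
  have hm1 : ∀ x, x ∈ σ.map (· + m') ↔ m' ≤ x ∧ x < m' + s := fun x => mem_map_add_iff hσ.1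
  have hp := e1 ▸ hmem.1
  obtain ⟨hnd, hx⟩ := std_iff.1 hp
  rw [mem_Pr]
  constructor
  · rintro ⟨h1, -, -, L', R', he, hsep⟩
    refine ⟨?_, h1⟩
    obtain ⟨rfl, rfl⟩ := split_unique hp (e1.symm.trans he)
    obtain ⟨r, hr, h2, h3⟩ := hsep (m' + s - 1) (List.mem_append_left _ ((hm1 _).2 (by omega)))
    have h4 : r ∉ σ.map (· + m') := fun h =>
      List.disjoint_of_nodup_append hnd (List.mem_append_left _ h) (by simp [hr])
    rw [hm1] at h4
    omega
  · rintro ⟨h1, h2⟩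
    have hlow : ∀ z ∈ σ.map (· + m') ++ L₂, z < m' + s := by
      intro z hz
      rcases List.mem_append.1 hz with h | h
      · exact ((hm1 z).1 h).2
      · obtain ⟨r, -, h3, h4⟩ := e3 z h
        omega
    refine ⟨h2, hmem.1, ⟨hmem.2, ?_⟩, _, R, e1, ?_⟩
    · intro b c d hs' hlt
      have hav := e1 ▸ hmem.2
      rw [e1] at hs'
      obtain ⟨l₁, l₂, he, hl₁, hl₂⟩ := List.sublist_append_iff.1 hs'
      cases l₁ with
      | cons x l₁ =>
        simp only [List.cons_append, List.cons.injEq] at he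
        have := hlow x (hl₁.subset (by simp))
        omega
      | nil =>
        simp only [List.nil_append] at he
        subst he
        -- A pattern `342` above the gap lies above the copy of `σ`, whose letters complete it.
        refine hav m' b c d (List.Sublist.append (List.singleton_sublist.2
          (List.mem_append_left _ ((hm1 m').2 (by omega)))) hl₂) ⟨by omega, hlt.2⟩
    · intro z hz
      have h3 := (hx (m' + s)).2 (by omega)
      rcases List.mem_append.1 h3 with h | h
      · exact absurd (hlow _ h) (lt_irrefl _)
      · rcases List.mem_cons.1 h with h | h
        · omega
        · exact ⟨m' + s, h, hlow z hz, h1⟩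

open Classical in
theorem sum_Pr_head_small (t : ℕ) (f : ℕ → ℚ[X]) :
    ∑ q ∈ (Pr t).filter (fun q => q.2.headD 0 + 1 < t), f q.1
      = ∑ T ∈ AvSmall t, ∑ m ∈ (Finset.range t).filter (fun m => (m, T) ∈ Pr t), f m := by
  have h : (Pr t).filter (fun q => q.2.headD 0 + 1 < t)
      = (Finset.range t ×ˢ AvSmall t).filter (fun q => q ∈ Pr t) := by
    ext ⟨m, T⟩
    simp only [Finset.mem_filter, Finset.mem_product, Finset.mem_range, AvSmall]
    constructor
    · rintro ⟨h1, h2⟩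
      have h3 := mem_Pr.1 h1
      exact ⟨⟨h3.1, mem_Av.2 ⟨h3.2.1, h3.2.2.1.1⟩, h2⟩, h1⟩
    · rintro ⟨⟨-, -, h2⟩, h1⟩
      exact ⟨h1, h2⟩
  rw [h, Finset.sum_filter, Finset.sum_product_right]
  simp_rw [Finset.sum_filter]

theorem sub_one_mul_sum_pow {c t : ℕ} (h : c < t) :
    ((X : ℚ[X]) - 1) * ∑ m ∈ (Finset.range t).filter (fun m => c < m), X ^ (t - m)
      = X ^ (t - c) - X := by
  have h1 : (Finset.range t).filter (fun m => c < m) = Finset.Ico (c + 1) t := by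
    ext
    simp only [Finset.mem_filter, Finset.mem_range, Finset.mem_Ico]
    omega
  obtain ⟨k, rfl⟩ : ∃ k, t = c + 1 + k := ⟨t - (c + 1), by omega⟩
  rw [h1, Finset.sum_Ico_eq_sum_range, ← Finset.sum_range_reflect, Nat.add_sub_cancel_left]
  have h2 : ∀ j ∈ Finset.range k, (X : ℚ[X]) ^ (c + 1 + k - (c + 1 + (k - 1 - j))) = X * X ^ j := by
    intro j hj
    rw [Finset.mem_range] at hj
    rw [← pow_succ']
    congr 1
    omega
  rw [Finset.sum_congr rfl h2, ← Finset.mul_sum, show c + 1 + k - c = k + 1 by omega, pow_succ']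
  linear_combination X * mul_geom_sum (X : ℚ[X]) k

theorem prPoly_succ (t : ℕ) :
    (X - 1) * (prPoly (t + 1) - X * avPoly (t + 1)) =
      ∑ st ∈ antidiagonal (t + 1),
        ((AvPos st.1).card : ℚ[X]) * (prPoly st.2 - X * ((Pr st.2).card : ℚ[X])) := by
  classical
  rw [prPoly, ← Finset.sum_filter_not_add_sum_filter _
    fun q : ℕ × List ℕ => q.2.headD 0 + 1 < t + 1, sum_Pr_head_max, add_sub_cancel_left,
    sum_Pr_head_small (t + 1) fun m => X ^ (t + 1 - m), sum_AvSmall, Finset.mul_sum]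
  refine Finset.sum_congr rfl ?_
  rintro ⟨s, t'⟩ hst
  rw [mem_antidiagonal] at hst
  dsimp only at hst ⊢
  rw [Finset.mul_sum, Finset.card_eq_sum_ones, Nat.cast_sum, Finset.sum_mul]
  refine Finset.sum_congr rfl fun σ hσ => ?_
  rw [mem_AvPos] at hσ
  rw [Finset.mul_sum, prPoly, Finset.card_eq_sum_ones, Nat.cast_sum, Finset.mul_sum,
    ← Finset.sum_sub_distrib, Nat.cast_one, one_mul]
  refine Finset.sum_congr rfl ?_
  rintro ⟨m', T⟩ hq
  have hm := (mem_Pr.1 hq).1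
  have h1 : (Finset.range (t + 1)).filter (fun m => (m, inflate σ m' T) ∈ Pr (t + 1))
      = (Finset.range (t + 1)).filter (fun m => m' + s < m) := by
    refine Finset.filter_congr fun m hmr => ?_
    rw [Finset.mem_range] at hmr
    rw [← hst, mem_Pr_inflate hσ.2 hσ.1 hq]
    omega
  dsimp only
  rw [h1, sub_one_mul_sum_pow (by omega), show t + 1 - (m' + s) = t' - m' by omega,
    mul_one]

theorem avPoly_zero : avPoly 0 = 0 := by simp [avPoly, AvPos]

theorem prPoly_zero : prPoly 0 = 0 := by
  have : Pr 0 = ∅ := Finset.eq_empty_of_forall_notMem fun ⟨m, T⟩ h => by simpa using (mem_Pr.1 h).1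
  simp [prPoly, this]

theorem eval_one_avPoly (n : ℕ) : (avPoly n).eval 1 = (AvPos n).card := by
  simp [avPoly, Polynomial.eval_finsetSum]

theorem eval_one_prPoly (n : ℕ) : (prPoly n).eval 1 = (Pr n).card := by
  simp [prPoly, Polynomial.eval_finsetSum]

theorem card_Av_zero : (Av 0).card = 1 := by
  rw [Finset.card_eq_one]
  refine ⟨[], Finset.eq_singleton_iff_unique_mem.2 ⟨mem_Av.2 ⟨by simp, ?_⟩, ?_⟩⟩
  · intro a b c d hs
    simp at hs
  · intro l hl
    simpa using (mem_Av.1 hl).1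

end Avoid1342

namespace Avoid1342

/-! ### The functional equation and its solution -/

open PowerSeries

/-- Square roots by the Catalan series: `r = 1 - 2 y C(y)`, where `C(y) = 1 + y C(y) ^ 2`. -/
theorem exists_sq_eq_one_sub {K : Type*} [CommRing K] (y : K⟦X⟧) (hy : constantCoeff y = 0) :
    ∃ r : K⟦X⟧, r ^ 2 = 1 - 4 * y ∧ constantCoeff r = 1 := by
  have hs : HasSubst y := HasSubst.of_constantCoeff_zero' hy
  have h := congrArg (fun f => substAlgHom (R := K) hs (PowerSeries.map (Nat.castRingHom K) f))
    catalanSeries_sq_mul_X_add_one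
  simp only [map_add, map_mul, map_pow, map_one, PowerSeries.map_X, substAlgHom_X] at h
  set c := substAlgHom (R := K) hs (PowerSeries.map (Nat.castRingHom K) catalanSeries)
  refine ⟨1 - 2 * y * c, ?_, by simp [hy]⟩
  linear_combination 4 * y * h

/-- The power series in `x` with coefficients in `ℚ[u]`. -/
local notation "𝓡" => PowerSeries (Polynomial ℚ)

/-- The inclusion of `ℚ⟦x⟧` in `ℚ[u]⟦x⟧`. -/
noncomputable def incl : ℚ⟦X⟧ →+* 𝓡 := PowerSeries.map Polynomial.C

/-- The substitution `u = 1`. -/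
noncomputable def evOne : 𝓡 →+* ℚ⟦X⟧ := PowerSeries.map (Polynomial.evalRingHom 1)

/-- The variable `u`. -/
noncomputable def uVar : 𝓡 := PowerSeries.C Polynomial.X

theorem evOne_incl (f : ℚ⟦X⟧) : evOne (incl f) = f := by
  ext n
  simp [evOne, incl]

theorem evOne_uVar : evOne uVar = 1 := by
  simp [evOne, uVar]

theorem evOne_X : evOne (X : 𝓡) = X := by simp [evOne]

theorem incl_X : incl X = (X : 𝓡) := by simp [incl]

theorem eq_zero_of_X_pow_dvd {f : 𝓡} (h : ∀ n : ℕ, (X : 𝓡) ^ n ∣ f) : f = 0 := by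
  ext1 n
  exact X_pow_dvd_iff.1 (h (n + 1)) n (by omega)

theorem X_pow_dvd_incl_evOne {f : 𝓡} {n : ℕ} (h : (X : 𝓡) ^ n ∣ f) :
    (X : 𝓡) ^ n ∣ incl (evOne f) := by
  obtain ⟨g, rfl⟩ := h
  simp [incl_X, evOne_X]

theorem X_pow_dvd_of_sub_one_mul {f : 𝓡} {n : ℕ} (h : (X : 𝓡) ^ n ∣ (uVar - 1) * f) :
    (X : 𝓡) ^ n ∣ f := by
  rw [X_pow_dvd_iff] at h ⊢
  intro m hm
  have h1 := h m hm
  have h2 : (uVar - 1 : 𝓡) = PowerSeries.C (Polynomial.X - 1) := by simp [uVar]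
  rw [h2, coeff_C_mul] at h1
  refine (mul_eq_zero.1 h1).resolve_left ?_
  simpa using Polynomial.X_sub_C_ne_zero (1 : ℚ)

/-- A linear equation `(u - 1) δ = x (a δ + b δ(1))` determines `δ` coefficient by coefficient. -/
theorem eq_zero_of_kernel {δ a b : 𝓡}
    (h : (uVar - 1) * δ = X * (a * δ + b * incl (evOne δ))) : δ = 0 := by
  refine eq_zero_of_X_pow_dvd fun n => ?_
  induction n with
  | zero => simp
  | succ n ih =>
    refine X_pow_dvd_of_sub_one_mul ?_
    rw [h, pow_succ']
    exact mul_dvd_mul_left _ (dvd_add (ih.mul_left _) ((X_pow_dvd_incl_evOne ih).mul_left _))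

/-- The functional equation satisfied by the generating function `A` of the nonempty 1342-avoiding
words, where `u` marks the letters that exceed the first one. -/
def FunEq (A : 𝓡) : Prop :=
  uVar * (1 - uVar) * A ^ 2 - (1 + incl (evOne A)) * (1 - uVar + uVar * X) * A
    + X * (1 + incl (evOne A)) * (1 + incl (evOne A) - uVar) = 0

theorem FunEq.unique {A B : 𝓡} (hA : FunEq A) (hB : FunEq B) (hA0 : (X : 𝓡) ∣ A)
    (hB0 : (X : 𝓡) ∣ B) : A = B := by
  obtain ⟨A', rfl⟩ := hA0
  obtain ⟨B', rfl⟩ := hB0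
  unfold FunEq at hA hB
  rw [← sub_eq_zero]
  have e1 : incl (evOne (X * A')) = X * incl (evOne A') := by simp [evOne_X, incl_X]
  have e2 : incl (evOne (X * B')) = X * incl (evOne B') := by simp [evOne_X, incl_X]
  rw [e1] at hA
  rw [e2] at hB
  set a := incl (evOne A')
  set b := incl (evOne B')
  refine eq_zero_of_kernel
    (a := (uVar - 1) * (-a + uVar * (A' + B') + (1 + X * a)) + (1 + X * a))
    (b := (uVar - 1) * (-B' + 1 + X * B') - (1 + X * a) + (X * B' - X * b)) ?_
  rw [map_sub, map_sub, e1, e2]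
  linear_combination hA - hB

theorem exists_sqrt_one_sub_eight_X : ∃ w : ℚ⟦X⟧, w ^ 2 = 1 - 8 * X ∧
    constantCoeff w = 1 ∧ ∀ n, coeff (n + 1) w = -(4 * 2 ^ n * (catalan n : ℚ)) := by
  set c : ℚ⟦X⟧ := rescale 2 (PowerSeries.map (Nat.castRingHom ℚ) catalanSeries) with hc
  have h := congrArg (fun f => rescale (2 : ℚ) (PowerSeries.map (Nat.castRingHom ℚ) f))
    catalanSeries_sq_mul_X_add_one
  simp only [map_add, map_mul, map_pow, map_one, PowerSeries.map_X, rescale_X, ← hc] at h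
  have h2 : (PowerSeries.C (2 : ℚ)) = 2 := map_ofNat _ 2
  rw [h2] at h
  refine ⟨1 - PowerSeries.C 4 * (X * c), ?_, by simp, fun n => ?_⟩
  · have h4 : (PowerSeries.C (4 : ℚ)) = 4 := map_ofNat _ 4
    rw [h4]
    linear_combination 8 * X * h
  · rw [map_sub, coeff_C_mul, coeff_succ_X_mul, coeff_one, if_neg (by omega), hc, coeff_rescale,
      coeff_map, catalanSeries_coeff]
    simp
    ring

/-- The explicit solution of the functional equation. With `w ^ 2 = 1 - 8 x`, the discriminant of
the equation is, up to a square factor, `1 - u (1 - w) (3 + w) / 4`; if `r` is its square root, then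
`A = 16 x ((3 + w) r + 1 + 3 w) / ((3 + w) ^ 2 (1 + r) (2 r + 1 + w))`. -/
theorem exists_funEq {w : ℚ⟦X⟧} (hw : w ^ 2 = 1 - 8 * X) (hw1 : constantCoeff w = 1) :
    ∃ B : 𝓡, FunEq B ∧ (X : 𝓡) ∣ B ∧ (1 + evOne B) * (3 + w) ^ 3 = 32 * (1 + w) := by
  set W := incl w with hW
  have hW2 : W ^ 2 = 1 - 8 * X := by 
    rw [hW, ← map_pow, hw]
    simp only [map_sub, map_mul, map_one, map_ofNat, incl_X]
  have hW1 : constantCoeff W = 1 := by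
    rw [hW, incl, ← coeff_zero_eq_constantCoeff_apply, coeff_map,
      coeff_zero_eq_constantCoeff_apply, hw1, map_one]
  -- The number `1 / 16` scales the radicand to the form `1 - 4 y`.
  set q : 𝓡 := PowerSeries.C (Polynomial.C (1 / 16 : ℚ)) with hq
  have hq16 : 16 * q = 1 := by
    rw [hq, ← map_ofNat (PowerSeries.C (R := Polynomial ℚ)) 16, ← map_mul,
      ← map_ofNat (Polynomial.C (R := ℚ)) 16, ← map_mul]
    norm_num
  obtain ⟨r, hr, hr1⟩ := exists_sq_eq_one_sub (q * (uVar * (1 - W) * (3 + W))) (by simp [hW1])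
  have hr4 : 4 * r ^ 2 = 4 - uVar * (1 - W) * (3 + W) := by
    linear_combination 4 * hr - uVar * (1 - W) * (3 + W) * hq16
  set D : 𝓡 := (3 + W) ^ 2 * ((1 + r) * (2 * r + 1 + W)) with hD
  have hDu : IsUnit D := by
    rw [isUnit_iff_constantCoeff, hD]
    simp only [map_mul, map_add, map_pow, map_one, map_ofNat, hW1, hr1]
    norm_num
    exact (Polynomial.isUnit_C (R := ℚ) (x := 128)).2 (by norm_num)
  obtain ⟨B, hB⟩ : ∃ B, B * D = X * (16 * ((3 + W) * r + 1 + 3 * W)) := by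
    obtain ⟨D', hD'⟩ := hDu.exists_right_inv
    exact ⟨X * (16 * ((3 + W) * r + 1 + 3 * W)) * D', by rw [mul_assoc, mul_comm D', hD', mul_one]⟩
  have hBX : (X : 𝓡) ∣ B := hDu.dvd_mul_right.1 ⟨_, hB⟩
  have hX : (8 : 𝓡) * X = 1 - W ^ 2 := by rw [hW2]; ring
  have hx : (8 : ℚ⟦X⟧) * X = 1 - w ^ 2 := by rw [hw]; ring
  -- At `u = 1` the radicand is the square of `(1 + w) / 2`.
  have hr₁ : 2 * evOne r = 1 + w := by
    have h1 := congrArg evOne hr4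
    simp only [map_mul, map_sub, map_add, map_pow, map_one, map_ofNat, evOne_uVar, hW,
      evOne_incl] at h1
    have h2 : (2 * evOne r) ^ 2 = (1 + w) ^ 2 := by linear_combination h1
    rcases sq_eq_sq_iff_eq_or_eq_neg.1 h2 with h | h
    · exact h
    · have h3 := congrArg constantCoeff h
      have h4 : constantCoeff (evOne r) = 1 := by
        rw [evOne, ← coeff_zero_eq_constantCoeff_apply, coeff_map,
          coeff_zero_eq_constantCoeff_apply, hr1, map_one]
      simp only [map_mul, map_neg, map_add, map_one, map_ofNat, h4, hw1] at h3
      norm_num at h3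
  have hS : (1 + evOne B) * (3 + w) ^ 3 = 32 * (1 + w) := by
    have h1 := congrArg evOne hB
    simp only [hD, map_mul, map_add, map_pow, map_one, map_ofNat, evOne_X, hW, evOne_incl] at h1
    have hne : (1 + w) ≠ 0 := fun h => by
      have := congrArg constantCoeff h
      simp only [map_add, map_one, hw1, map_zero] at this
      norm_num at this
    refine mul_left_cancel₀ hne ?_
    set ρ := evOne r
    set β := evOne B
    linear_combination h1 - β * (3 + w) ^ 2 * (2 + ρ + w) * hr₁
      + (5 + 10 * w + w ^ 2) * hx + 8 * X * (3 + w) * hr₁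
  refine ⟨B, ?_, hBX, hS⟩
  have hS' : (1 + incl (evOne B)) * (3 + W) ^ 3 = 32 * (1 + W) := by
    have := congrArg incl hS
    simpa only [map_mul, map_add, map_pow, map_one, map_ofNat] using this
  have hW3 : (3 + W) ^ 6 * ((1 + r) * (2 * r + 1 + W)) ^ 2 ≠ 0 := fun h => by
    have := congrArg constantCoeff h
    simp only [map_mul, map_add, map_pow, map_one, map_ofNat, hW1, hr1, map_zero] at this
    norm_num at this
  unfold FunEq
  refine (mul_eq_zero.1
    (?_ : (3 + W) ^ 6 * ((1 + r) * (2 * r + 1 + W)) ^ 2 * _ = 0)).resolve_left hW3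
  set S := 1 + incl (evOne B)
  set n := (3 + W) * r + 1 + 3 * W with hn
  set E := (1 + r) * (2 * r + 1 + W) with hE
  -- After multiplication by the squared denominator, the equation is polynomial in `u`, `w` and
  -- `r`, and it is a multiple of the equation for `r ^ 2`.
  have hBn : B * (3 + W) ^ 2 * E = 2 * (1 - W ^ 2) * n := by
    rw [hD] at hB
    linear_combination hB + 2 * n * hX
  have key : uVar * (1 - uVar) * (1 - W) * n ^ 2 * (3 + W) ^ 2
      - 2 * (8 * (1 - uVar) + uVar * (1 - W ^ 2)) * n * E * (3 + W)
      + (32 * (1 + W) - uVar * (3 + W) ^ 3) * E ^ 2 = 0 := by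
    rw [hE, hn]
    linear_combination (-((3 + W) * r + 1 + 3 * W) ^ 2 * (3 + W) * uVar
      + 4 * (2 * r + 1 + W) * (4 * (1 + W) * r + 1 + 6 * W + W ^ 2)) * hr4
  have t1 : (3 + W) ^ 6 * E ^ 2 * (uVar * (1 - uVar) * B ^ 2)
      = uVar * (1 - uVar) * (3 + W) ^ 2 * (2 * (1 - W ^ 2) * n) ^ 2 := by
    rw [← hBn]
    ring
  have t2 : (3 + W) ^ 6 * E ^ 2 * (S * (1 - uVar + uVar * X) * B)
      = (1 - uVar + uVar * X) * (3 + W) * E * (32 * (1 + W)) * (2 * (1 - W ^ 2) * n) := by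
    rw [← hBn, ← hS']
    ring
  have t3 : (3 + W) ^ 6 * E ^ 2 * (X * S * (S - uVar))
      = X * E ^ 2 * (32 * (1 + W)) * (32 * (1 + W) - uVar * (3 + W) ^ 3) := by
    rw [← hS']
    ring
  rw [mul_add, mul_sub, t1, t2, t3]
  linear_combination 4 * (1 - W ^ 2) * (1 + W) * key
    + (E ^ 2 * (4 * (1 + W)) * (32 * (1 + W) - uVar * (3 + W) ^ 3)
      - uVar * (3 + W) * E * (4 * (1 + W)) * (2 * (1 - W ^ 2) * n)) * hX

/-- The generating function of the nonempty 1342-avoiding words. -/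
noncomputable def avSeries : 𝓡 := PowerSeries.mk avPoly

/-- The ordinary generating function of the numbers of 1342-avoiding words. -/
noncomputable def countSeries : ℚ⟦X⟧ := PowerSeries.mk fun n => ((Av n).card : ℚ)

theorem evOne_avSeries : 1 + evOne avSeries = countSeries := by
  ext n
  rw [map_add, evOne, avSeries, countSeries, coeff_map, coeff_mk, coeff_mk,
    Polynomial.coe_evalRingHom, eval_one_avPoly, coeff_one, AvPos]
  split_ifs with h
  · simp [h, card_Av_zero]
  · simp

theorem avSeries_eq :
    avSeries = X * incl countSeries + avSeries * PowerSeries.mk prPoly := by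
  ext1 n
  cases n with
  | zero => simp [avSeries, avPoly_zero]
  | succ n =>
    rw [map_add, coeff_succ_X_mul, coeff_mul]
    simp only [avSeries, incl, countSeries, coeff_map, coeff_mk, map_natCast]
    exact avPoly_succ n

theorem prSeries_eq :
    (uVar - 1) * (PowerSeries.mk prPoly - uVar * avSeries)
      = incl (evOne avSeries) *
        (PowerSeries.mk prPoly - uVar * incl (evOne (PowerSeries.mk prPoly))) := by
  have h2 : (uVar - 1 : 𝓡) = PowerSeries.C (Polynomial.X - 1) := by simp [uVar]
  ext1 n
  rw [h2, coeff_C_mul, coeff_mul]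
  have h3 : ∀ s, coeff s (incl (evOne avSeries)) = ((AvPos s).card : Polynomial ℚ) := by
    intro s
    simp [incl, evOne, avSeries, eval_one_avPoly]
  have h4 : ∀ s, coeff s (PowerSeries.mk prPoly - uVar * incl (evOne (PowerSeries.mk prPoly)))
      = prPoly s - Polynomial.X * ((Pr s).card : Polynomial ℚ) := by
    intro s
    simp [incl, evOne, uVar, eval_one_prPoly]
  simp only [h3, h4]
  cases n with
  | zero => simp [avSeries, avPoly_zero, prPoly_zero, uVar, AvPos]
  | succ n =>
    rw [← prPoly_succ n]
    simp [avSeries, uVar]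

theorem funEq_avSeries : FunEq avSeries := by
  have h1 := avSeries_eq
  have h2 := prSeries_eq
  have h3 := congrArg (fun f => incl (evOne f)) h1
  simp only [map_add, map_mul, evOne_X, evOne_incl, incl_X] at h3
  have h4 : incl countSeries = 1 + incl (evOne avSeries) := by
    rw [← evOne_avSeries, map_add, map_one]
  unfold FunEq
  rw [h4] at h1 h3
  set a := incl (evOne avSeries)
  set A := avSeries
  set Q : 𝓡 := PowerSeries.mk prPoly
  set q := incl (evOne Q)
  -- `h3` is `h1` at `u = 1`, which expresses `Q(1)` through `S`.
  linear_combination A * h2 + (uVar - 1 - a) * h1 + uVar * A * h3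

/-- The closed form of the generating function of the 1342-avoiders, with `w = √(1 - 8 x)`. -/
theorem countSeries_mul {w : ℚ⟦X⟧} (hw : w ^ 2 = 1 - 8 * X) (hw1 : constantCoeff w = 1) :
    countSeries * (1 + 20 * X - 8 * X ^ 2 - (1 - 8 * X) * w) = 32 * X := by
  obtain ⟨B, hB, hBX, hS⟩ := exists_funEq hw hw1
  have hAX : (X : 𝓡) ∣ avSeries := by
    rw [X_dvd_iff, avSeries, ← coeff_zero_eq_constantCoeff_apply, coeff_mk, avPoly_zero]
  rw [← funEq_avSeries.unique hB hAX hBX, evOne_avSeries] at hS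
  have h8 : (PowerSeries.C (8 : ℚ)) ≠ 0 := by simp
  have h8' : (PowerSeries.C (8 : ℚ)) = 8 := map_ofNat _ 8
  refine mul_left_cancel₀ (h8' ▸ h8) ?_
  have hX : (8 : ℚ⟦X⟧) * X = 1 - w ^ 2 := by rw [hw]; ring
  have e : 8 * (1 + 20 * X - 8 * X ^ 2 - (1 - 8 * X) * w) = (1 - w) * (3 + w) ^ 3 := by
    linear_combination (20 - (8 * X + (1 - w ^ 2)) + 8 * w) * hX
  linear_combination countSeries * e + (1 - w) * hS - 32 * hX

end Avoid1342

namespace Avoid1342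

/-! ### Permutations as words -/

/-- The one-line notation of a permutation. -/
def word {n : ℕ} (p : Equiv.Perm (Fin n)) : List ℕ := List.ofFn fun i => (p i : ℕ)

theorem word_perm {n : ℕ} (p : Equiv.Perm (Fin n)) : (word p).Perm (List.range n) := by
  rw [std_iff]
  constructor
  · exact List.nodup_ofFn.2 (Fin.val_injective.comp p.injective)
  · intro x
    rw [word, List.mem_ofFn]
    exact ⟨by rintro ⟨i, rfl⟩; exact (p i).2, fun h => ⟨p.symm ⟨x, h⟩, by simp⟩⟩

theorem avoids_word_iff {n : ℕ} (p : Equiv.Perm (Fin n)) :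
    Avoids (word p) ↔ AvoidsPattern pattern1342 p := by
  have hlen : (word p).length = n := by simp [word]
  constructor
  · rintro h ⟨f, hf⟩
    refine h (p (f 0)) (p (f 1)) (p (f 2)) (p (f 3)) ?_ ⟨?_, ?_, ?_⟩
    · rw [List.sublist_iff_exists_fin_orderEmbedding_get_eq]
      refine ⟨OrderEmbedding.ofStrictMono (α := Fin 4) (fun i => Fin.cast hlen.symm (f i))
        fun i j hij => f.strictMono hij, fun i => ?_⟩
      fin_cases i <;> simp [word] <;> rfl
    · exact (hf 0 3).1 (by decide)
    · exact (hf 3 1).1 (by decide)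
    · exact (hf 1 2).1 (by decide)
  · intro h a b c d hs hlt
    obtain ⟨f, hf⟩ := List.sublist_iff_exists_fin_orderEmbedding_get_eq.1 hs
    let g : Fin 4 ↪o Fin n := OrderEmbedding.ofStrictMono (fun i => Fin.cast hlen (f i))
      fun i j hij => f.strictMono hij
    have hval : ∀ i : Fin 4, (word p).get (f i) = (p (g i) : ℕ) := by
      intro i
      simp only [word, List.get_ofFn]
      rfl
    have h0 : a = (p (g 0) : ℕ) := (hf (0 : Fin 4)).trans (hval 0)
    have h1 : b = (p (g 1) : ℕ) := (hf (1 : Fin 4)).trans (hval 1)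
    have h2 : c = (p (g 2) : ℕ) := (hf (2 : Fin 4)).trans (hval 2)
    have h3 : d = (p (g 3) : ℕ) := (hf (3 : Fin 4)).trans (hval 3)
    refine h ⟨g, fun x y => ?_⟩
    rw [Fin.lt_def (a := p (g x))]
    fin_cases x <;> fin_cases y <;>
      simp only [Fin.zero_eta, Fin.mk_one, Fin.reduceFinMk, ← h0, ← h1, ← h2, ← h3] <;>
      simp [pattern1342] <;> omega

theorem avoidCount_eq (n : ℕ) : avoidCount pattern1342 n = (Av n).card := by
  rw [avoidCount, ← Fintype.card_coe, ← Nat.card_eq_fintype_card]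
  refine Nat.card_congr (Equiv.ofBijective
    (fun p => ⟨word p.1, mem_Av.2 ⟨word_perm p.1, (avoids_word_iff p.1).2 p.2⟩⟩) ⟨?_, ?_⟩)
  · rintro ⟨p, hp⟩ ⟨p', hp'⟩ h
    simp only [Subtype.mk.injEq, word, List.ofFn_inj] at h ⊢
    ext i
    exact congrFun h i
  · rintro ⟨l, hl⟩
    rw [mem_Av] at hl
    obtain ⟨hl, ha⟩ := hl
    have hlen := length_of_perm_range hl
    subst hlen
    obtain ⟨hnd, hmem⟩ := std_iff.1 hl
    let g : Fin l.length → Fin l.length := fun i => ⟨l.get i, (hmem _).1 (List.get_mem l i)⟩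
    have hg : Function.Injective g := fun i j h =>
      List.nodup_iff_injective_get.1 hnd (congrArg Fin.val h)
    have hw : word (Equiv.ofBijective g (Finite.injective_iff_bijective.1 hg)) = l := by
      simp [word, g]
    exact ⟨⟨_, (avoids_word_iff _).1 (hw.symm ▸ ha)⟩, Subtype.ext hw⟩

/-! ### The skew-indecomposable 1342-avoiders -/

open Finset.HasAntidiagonal (antidiagonal mem_antidiagonal)

/-- The coefficients of `1 - 1 / S(x)`, where `S` is the generating function of the 1342-avoiders;
they are the numbers of 1342-avoiders that are indecomposable with respect to skew sums. -/
noncomputable def indec : ℕ → ℚ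
  | 0 => 0
  | 1 => 1
  | n + 2 => 2 ^ n / 2 * (4 * catalan (n + 1) - catalan (n + 2))

open PowerSeries in
theorem countSeries_mul_one_sub : countSeries * (1 - PowerSeries.mk indec) = 1 := by
  obtain ⟨w, hw, hw1, hwc⟩ := exists_sqrt_one_sub_eight_X
  have h := countSeries_mul hw hw1
  have key : 1 + 20 * X - 8 * X ^ 2 - (1 - 8 * X) * w = 32 * X * (1 - PowerSeries.mk indec) := by
    have e20 : (20 : ℚ⟦X⟧) = C 20 := (map_ofNat C 20).symm
    have e8 : (8 : ℚ⟦X⟧) = C 8 := (map_ofNat C 8).symm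
    have e32 : (32 : ℚ⟦X⟧) = C 32 := (map_ofNat C 32).symm
    have hexp : 1 + 20 * X - 8 * X ^ 2 - (1 - 8 * X) * w
        = 1 + C 20 * X - C 8 * X ^ 2 - w + C 8 * (X * w) := by
      rw [e20, e8]
      ring
    rw [hexp, e32, mul_assoc]
    have hw0 : coeff 0 w = 1 := by rw [coeff_zero_eq_constantCoeff_apply, hw1]
    ext n
    rcases n with _ | _ | _ | n
    · simp [hw1]
    · simp only [map_add, map_sub, coeff_C_mul, coeff_succ_X_mul, hwc, coeff_mk, hw0, coeff_one,
        coeff_X, coeff_X_pow]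
      norm_num [indec]
    · simp only [map_add, map_sub, coeff_C_mul, coeff_succ_X_mul, hwc, coeff_mk, coeff_one,
        coeff_X, coeff_X_pow]
      norm_num [indec]
    · simp only [map_add, map_sub, coeff_C_mul, coeff_succ_X_mul, hwc, coeff_mk, coeff_one,
        coeff_X, coeff_X_pow]
      simp [indec]
      ring
  rw [key] at h
  have h32 : (32 * X : ℚ⟦X⟧) ≠ 0 := by
    intro h0
    have := congrArg (coeff 1) h0
    rw [show (32 : ℚ⟦X⟧) = C 32 from (map_ofNat C 32).symm, coeff_C_mul] at this
    simp at this
  refine mul_left_cancel₀ h32 ?_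
  linear_combination h

theorem card_Av_succ (n : ℕ) : ((Av (n + 1)).card : ℚ) =
    ∑ st ∈ antidiagonal (n + 1), ((Av st.1).card : ℚ) * indec st.2 := by
  have h := congrArg (PowerSeries.coeff (n + 1)) countSeries_mul_one_sub
  rw [mul_sub, mul_one, map_sub, PowerSeries.coeff_mul, PowerSeries.coeff_one,
    if_neg (by omega), sub_eq_zero] at h
  simpa [countSeries] using h

theorem catalan_rec (n : ℕ) :
    ((n : ℚ) + 3) * catalan (n + 2) = 2 * (2 * n + 3) * catalan (n + 1) := by
  have h1 : (((n + 2 + 1) * catalan (n + 2) : ℕ) : ℚ) = _ :=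
    congrArg Nat.cast (succ_mul_catalan_eq_centralBinom (n + 2))
  have h2 : (((n + 1 + 1) * catalan (n + 1) : ℕ) : ℚ) = _ :=
    congrArg Nat.cast (succ_mul_catalan_eq_centralBinom (n + 1))
  have h3 : (((n + 1 + 1) * (n + 1 + 1).centralBinom : ℕ) : ℚ) = _ :=
    congrArg Nat.cast (Nat.succ_mul_centralBinom_succ (n + 1))
  push_cast at h1 h2 h3
  have h4 : (n : ℚ) + 2 ≠ 0 := by positivity
  refine mul_left_cancel₀ h4 ?_
  linear_combination (n + 2) * h1 + h3 - 2 * (2 * n + 3) * h2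

theorem indec_add_two (n : ℕ) : indec (n + 2) = 3 * 2 ^ n * catalan (n + 1) / (n + 3) := by
  have h := catalan_rec n
  have h3 : (n : ℚ) + 3 ≠ 0 := by positivity
  rw [indec, eq_div_iff h3]
  linear_combination -(2 ^ n / 2) * h

theorem indec_nonneg (n : ℕ) : 0 ≤ indec n := by
  rcases n with _ | _ | n
  · simp [indec]
  · simp [indec]
  · rw [indec_add_two]
    positivity

theorem indec_le_card_Av (n : ℕ) : indec n ≤ (Av n).card := by
  cases n with
  | zero => simp [indec]
  | succ n =>
    rw [card_Av_succ]
    have := Finset.single_le_sum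
      (f := fun st : ℕ × ℕ => ((Av st.1).card : ℚ) * indec st.2)
      (fun st _ => mul_nonneg (Nat.cast_nonneg _) (indec_nonneg _))
      ((mem_antidiagonal (a := (0, n + 1))).2 (zero_add (n + 1)))
    simpa [card_Av_zero] using this

/-- The sums `∑ I_j / 8 ^ j` telescope, as `I_j` is a difference of consecutive Catalan numbers
scaled by powers of `4`. -/
theorem sum_indec_div (n : ℕ) : ∑ j ∈ Finset.range (n + 2), indec j / 8 ^ j
    = 5 / 32 - catalan (n + 1) / (8 * 4 ^ (n + 1)) := by
  induction n with
  | zero => norm_num [Finset.sum_range_succ, indec]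
  | succ n ih =>
    rw [Finset.sum_range_succ, ih, indec]
    have h8 : (8 : ℚ) ^ (n + 2) = 64 * (2 ^ n * 4 ^ n) := by
      rw [← mul_pow]
      norm_num
      ring
    rw [h8]
    have h2 : (2 : ℚ) ^ n ≠ 0 := by positivity
    field_simp
    ring

theorem card_Av_lt (n : ℕ) (hn : 1 ≤ n) : ((Av n).card : ℚ) < 8 ^ n := by
  induction n using Nat.strong_induction_on with
  | _ n ih =>
    obtain ⟨k, rfl⟩ : ∃ k, n = k + 1 := ⟨n - 1, by omega⟩
    have hle : ∀ st ∈ antidiagonal (k + 1),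
        ((Av st.1).card : ℚ) * indec st.2 ≤ 8 ^ (k + 1) * (indec st.2 / 8 ^ st.2) := by
      rintro ⟨s, t⟩ hst
      rw [mem_antidiagonal] at hst
      dsimp only at hst ⊢
      have h1 : (8 : ℚ) ^ (k + 1) * (indec t / 8 ^ t) = 8 ^ s * indec t := by
        rw [← hst, pow_add]
        field_simp
      rw [h1]
      rcases Nat.eq_zero_or_pos t with rfl | ht
      · simp [indec]
      · refine mul_le_mul_of_nonneg_right ?_ (indec_nonneg t)
        rcases Nat.eq_zero_or_pos s with rfl | hs
        · simp [card_Av_zero]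
        · exact (ih s (by omega) hs).le
    rw [card_Av_succ]
    refine (Finset.sum_le_sum hle).trans_lt ?_
    rw [← Finset.mul_sum, ← Finset.Nat.sum_antidiagonal_swap,
      Finset.Nat.sum_antidiagonal_eq_sum_range_succ_mk]
    simp only [Prod.snd_swap]
    rw [sum_indec_div]
    have hc : (0 : ℚ) ≤ catalan (k + 1) / (8 * 4 ^ (k + 1)) := by positivity
    have h8 : (0 : ℚ) < 8 ^ (k + 1) := by positivity
    nlinarith

/-! ### Growth -/

theorem tutteNumber_eq_indec (n : ℕ) : tutteNumber (n + 1) = ((indec (n + 2) : ℚ) : ℝ) := by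
  rw [indec_add_two, tutteNumber, Nat.add_sub_cancel]
  have h1 : (((n + 1 + 1) * catalan (n + 1) : ℕ) : ℝ) = _ :=
    congrArg Nat.cast (succ_mul_catalan_eq_centralBinom (n + 1))
  have h2 : (((n + 1).centralBinom * (n + 1)! * (n + 1)! : ℕ) : ℝ) = ((2 * (n + 1))! : ℕ) := by
    rw [Nat.centralBinom]
    have := Nat.choose_mul_factorial_mul_factorial (show n + 1 ≤ 2 * (n + 1) by omega)
    rw [show 2 * (n + 1) - (n + 1) = n + 1 by omega] at this
    rw [this]
  rw [Nat.factorial_succ (n + 1 + 1), Nat.factorial_succ (n + 1)]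
  push_cast at h1 h2 ⊢
  rw [← h2, ← h1]
  have h3 : ((n + 1)! : ℝ) ≠ 0 := by positivity
  have h4 : (n : ℝ) + 1 + 1 + 1 ≠ 0 := by positivity
  have h5 : (n : ℝ) + 3 ≠ 0 := by positivity
  field_simp
  ring

theorem tutteNumber_rec (n : ℕ) (hn : 2 ≤ n) :
    tutteNumber n = (8 * (n : ℝ) - 4) * tutteNumber (n - 1) / ((n : ℝ) + 2) := by
  obtain ⟨k, rfl⟩ : ∃ k, n = k + 2 := ⟨n - 2, by omega⟩
  simp only [tutteNumber, show k + 2 - 1 = k + 1 by omega, show k + 1 - 1 = k by omega,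
    show 2 * (k + 2) = 2 * (k + 1) + 1 + 1 by ring, Nat.factorial_succ (2 * (k + 1) + 1),
    Nat.factorial_succ (2 * (k + 1)), show k + 2 + 2 = (k + 1 + 2) + 1 by ring,
    Nat.factorial_succ (k + 1 + 2), show k + 2 = (k + 1) + 1 by ring, Nat.factorial_succ (k + 1)]
  have h3 : ((k + 1)! : ℝ) ≠ 0 := by positivity
  have h4 : ((k + 1 + 2)! : ℝ) ≠ 0 := by positivity
  push_cast
  field_simp
  ring

theorem le_tutteNumber (n : ℕ) (hn : 2 ≤ n) :
    (8 : ℝ) ^ n / (16 * (n : ℝ) ^ 3) ≤ tutteNumber (n - 1) := by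
  obtain ⟨k, rfl⟩ : ∃ k, n = k + 2 := ⟨n - 2, by omega⟩
  rw [show k + 2 - 1 = k + 1 by omega, tutteNumber_eq_indec, indec_add_two]
  have h1 : (((k + 1 + 1) * catalan (k + 1) : ℕ) : ℝ) = _ :=
    congrArg Nat.cast (succ_mul_catalan_eq_centralBinom (k + 1))
  have h2 : ((4 ^ (k + 1) : ℕ) : ℝ) ≤ ((2 * (k + 1) * (k + 1).centralBinom : ℕ) : ℝ) :=
    Nat.cast_le.2 (Nat.four_pow_le_two_mul_self_mul_centralBinom (k + 1) (by omega))
  push_cast at h1 h2 ⊢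
  rw [← h1] at h2
  rw [div_le_div_iff₀ (by positivity) (by positivity)]
  have h8 : (8 : ℝ) ^ (k + 2) = 16 * 2 ^ k * 4 ^ (k + 1) := by
    rw [pow_succ 4 k, show (8 : ℝ) = 2 * 4 by norm_num, mul_pow]
    ring
  rw [h8]
  set c : ℝ := (catalan (k + 1) : ℝ)
  have hc : 0 ≤ c := Nat.cast_nonneg _
  have hk : (0 : ℝ) ≤ k := Nat.cast_nonneg _
  have h9 : (4 : ℝ) ^ (k + 1) * (k + 3) ≤ 3 * c * (k + 2) ^ 3 := by
    refine (mul_le_mul_of_nonneg_right h2 (by positivity)).trans ?_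
    have : 2 * ((k : ℝ) + 1) * (k + 3) ≤ 3 * (k + 2) ^ 2 := by nlinarith
    have := mul_le_mul_of_nonneg_right this (mul_nonneg hc (by positivity : (0 : ℝ) ≤ k + 2))
    linarith
  have := mul_le_mul_of_nonneg_left h9 (by positivity : (0 : ℝ) ≤ 16 * 2 ^ k)
  linarith

/-- A sequence between `8 ^ n / (16 n ^ 3)` and `8 ^ n` has `n`-th roots converging to `8`. -/
theorem tendsto_root_of_bounds {f : ℕ → ℝ}
    (h1 : ∀ n : ℕ, 2 ≤ n → (8 : ℝ) ^ n / (16 * (n : ℝ) ^ 3) ≤ f n)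
    (h2 : ∀ n : ℕ, 2 ≤ n → f n ≤ 8 ^ n) :
    Tendsto (fun n : ℕ => f n ^ (1 / (n : ℝ))) atTop (𝓝 8) := by
  have hlim : Tendsto (fun n : ℕ => (8 : ℝ) / ((16 : ℝ) ^ (1 / (n : ℝ)) *
      ((n : ℝ) ^ (1 / (n : ℝ))) ^ 3)) atTop (𝓝 8) := by
    have a1 : Tendsto (fun n : ℕ => (n : ℝ) ^ (1 / (n : ℝ))) atTop (𝓝 1) :=
      tendsto_rpow_div.comp tendsto_natCast_atTop_atTop
    have a2 : Tendsto (fun n : ℕ => (16 : ℝ) ^ (1 / (n : ℝ))) atTop (𝓝 1) := by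
      have := (Real.continuous_const_rpow (a := 16) (by norm_num)).continuousAt.tendsto.comp
        (tendsto_one_div_atTop_nhds_zero_nat (𝕜 := ℝ))
      rwa [Real.rpow_zero] at this
    have := (tendsto_const_nhds (x := (8 : ℝ))).div (a2.mul (a1.pow 3)) (by norm_num)
    rwa [one_pow, mul_one, div_one] at this
  refine tendsto_of_tendsto_of_tendsto_of_le_of_le' hlim tendsto_const_nhds ?_ ?_
  · filter_upwards [eventually_ge_atTop 2] with n hn
    have hn0 : (0 : ℝ) < n := by positivity
    have e : (8 : ℝ) / ((16 : ℝ) ^ (1 / (n : ℝ)) * ((n : ℝ) ^ (1 / (n : ℝ))) ^ 3)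
        = ((8 : ℝ) ^ n / (16 * (n : ℝ) ^ 3)) ^ (1 / (n : ℝ)) := by
      rw [Real.div_rpow (by positivity) (by positivity), Real.mul_rpow (by positivity)
        (by positivity), one_div, Real.pow_rpow_inv_natCast (by positivity) (by omega),
        ← Real.rpow_natCast, ← Real.rpow_natCast, ← Real.rpow_mul hn0.le, ← Real.rpow_mul hn0.le,
        mul_comm (n : ℝ)⁻¹]
    rw [e]
    exact Real.rpow_le_rpow (by positivity) (h1 n hn) (by positivity)
  · filter_upwards [eventually_ge_atTop 2] with n hn
    have h0 : 0 ≤ f n := le_trans (by positivity) (h1 n hn)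
    refine (Real.rpow_le_rpow h0 (h2 n hn) (by positivity)).trans_eq ?_
    rw [one_div, Real.pow_rpow_inv_natCast (by positivity) (by omega)]

theorem tutteNumber_le_avoidCount (n : ℕ) (hn : 2 ≤ n) :
    tutteNumber (n - 1) ≤ (avoidCount pattern1342 n : ℝ) := by
  obtain ⟨k, rfl⟩ : ∃ k, n = k + 2 := ⟨n - 2, by omega⟩
  rw [show k + 2 - 1 = k + 1 by omega, tutteNumber_eq_indec, avoidCount_eq]
  exact_mod_cast indec_le_card_Av (k + 2)

theorem avoidCount_lt (n : ℕ) (hn : 1 ≤ n) : avoidCount pattern1342 n < 8 ^ n := by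
  rw [avoidCount_eq]
  exact_mod_cast card_Av_lt n hn

theorem tendsto_root_avoidCount :
    Tendsto (fun n : ℕ => (avoidCount pattern1342 n : ℝ) ^ (1 / (n : ℝ))) atTop (𝓝 8) :=
  tendsto_root_of_bounds
    (fun n hn => (le_tutteNumber n hn).trans (tutteNumber_le_avoidCount n hn))
    (fun n hn => by exact_mod_cast (avoidCount_lt n (by omega)).le)

end Avoid1342

theorem mainTheorem4 :
    Tendsto (fun n : ℕ => (avoidCount pattern1342 n : ℝ) ^ (1 / (n : ℝ))) atTop (𝓝 8) ∧
    (∀ n : ℕ, 1 ≤ n → avoidCount pattern1342 n < 8 ^ n) ∧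
    (∀ n : ℕ, 2 ≤ n → tutteNumber (n - 1) ≤ (avoidCount pattern1342 n : ℝ)) ∧
    (∀ n : ℕ, 2 ≤ n →
      tutteNumber n = (8 * (n : ℝ) - 4) * tutteNumber (n - 1) / ((n : ℝ) + 2)) ∧
    ¬ StanleyConjectureFor pattern1342 := by
  refine ⟨Avoid1342.tendsto_root_avoidCount, Avoid1342.avoidCount_lt,
    Avoid1342.tutteNumber_le_avoidCount, Avoid1342.tutteNumber_rec, fun h => ?_⟩
  have := tendsto_nhds_unique h Avoid1342.tendsto_root_avoidCount
  norm_num at this
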